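/- **Setting.** A Fibonacci word is a finite word $w$ in the letters $1,2$; its weight $|w|$ is the sum of its letters, and $\mathbb{YF}_n$ is the set of Fibonacci words of weight $n$. In the Young--Fibonacci lattice, $w\nearrow w'$ (for $|w'|=|w|+1$) holds if and only if $w'=1w$, or $w=2^k1v$ and $w'=2^{k+1}v$ for some $k\ge 0$, or $w=2^kv$ and $w'=2^{\ell}12^{k-\ell}v$ for some $1\le \ell\le k$ ($v$ an arbitrary Fibonacci word). Let $\dim w$ be the number of saturated chains $\varnothing=w_0\nearrow\cdots\nearrow w_n=w$, and let $\varphi_{\mathrm{PL}}(w)=\dim(w)/|w|!$. For sequences $\vec x=(x_1,x_2,\dots)$, $\vec y=(y_1,y_2,\dots)$ let $A_k(\vec x\mid\vec y)$ be the $k\times k$ tridiagonal determinant with diagonal $x_1,x_2,x_3,\dots$, superdiagonal $y_1,y_2,y_3,\dots$ and subdiagonal $1,1,\dots$, and let $B_k(\vec x\mid\vec y)$ be the $(k+1)\times(k+1)$ tridiagonal determinant with diagonal $y_1,x_3,x_4,\dots$, superdiagonal $x_1y_2,y_3,y_4,\dots$ and subdiagonal $1,1,\dots$. The clone Schur functions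 are given by $s_{1^k}=A_k(\vec x\mid\vec y)$ and $s_{1^k2u}=B_k(\vec x+|u|\mid\vec y+|u|)\,s_u(\vec x\mid \vec y)$, where $\vec x+m=(x_{1+m},x_{2+m},\dots)$; put $\varphi_{\vec x,\vec y}(w)=s_w(\vec x\mid\vec y)/(x_1\cdots x_{|w|})$. For a positive function $\varphi$ on Fibonacci words, the cotransition probability $\mu^{\varphi}_{\mathrm{CT}}(w,v)$ equals $1$ if $w=1v$, equals $\varphi(v)/\varphi(u)$ if $w=2u$ and $v\nearrow w$, and is $0$ if $v\not\nearrow w$. For a permutation $s\in\mathfrak S_n$ in one-line notation, the Young--Fibonacci Robinson--Schensted insertion tableau $P(s)$ is obtained as follows: repeatedly take the rightmost unmatched entry $a$ and the maximal unmatched entry $m$ among $a$ and the entries to its left; if $m=a$, write the column $a$ of height one, otherwise the column of height two with $m$ above $a$; the columns are written from left to right. The shape of $P(s)$ is the Fibonacci word of its column heights. The elimination map $\mathcal E$ deletes the top entry of the first column of a tableau. If that column had height two, its bottom entry $a$ is left over: if the top (or only) entry $c$ of the next column exceeds $a$, then $c$ moves on top of $a$, and if there was an entry $b$ below $c$, the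 same step is repeated with $b$ in place of $a$; if $c<a$, or if there is no next column, $a$ remains as a column of height one. Let $w_k$ be the shape of $\mathcal E^{\,n-k}P(s)$, and put $\overline\mu^{\varphi}_{\mathrm{CT}}(P(s))=\prod_{k=1}^n\mu^{\varphi}_{\mathrm{CT}}(w_k,w_{k-1})$. For involutions $s\in\mathfrak S_n$ (including the identity) with $w$ the shape of $P(s)$, let $$\nu_n(s)=\dim(w)\,\varphi_{\vec x,\vec y}(w)\,\overline\mu^{\varphi_{\mathrm{PL}}}_{\mathrm{CT}}(P(s)).$$ **Statement.** Let $\sigma\in[1,\infty)$ and let $x_k=y_k=k+\sigma-1$ for $k\ge1$ (the shifted Plancherel specialization). Then for every $n\ge 0$, $\nu_n$ is a probability measure on the set of involutions of $\mathfrak S_n$, and the expected number of two-cycles $$G_n(\sigma)=\mathbb E_{\nu_n}\bigl[\#\,\text{two-cycles}(s)\bigr]$$ satisfies $$\lim_{n\to\infty}\frac{G_n(\sigma)}{n}=\frac1{\sigma+1}.$$ -/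

import Mathlib

open Filter Topology

namespace YoungFibonacci

/-- The two letters of Fibonacci words. -/
inductive Letter where
  | one : Letter
  | two : Letter

/-- Fibonacci words: finite words in the letters `1` and `2`, read from left to right. -/
abbrev FibWord := List Letter

/-- The numerical value of a letter. -/
def Letter.val : Letter → ℕ
  | Letter.one => 1
  | Letter.two => 2

/-- The weight `|w|`, the sum of the letters of `w`. -/
def weight (w : FibWord) : ℕ := (w.map Letter.val).sum

/-- The word `2^k`. -/
def twos (k : ℕ) : FibWord := List.replicate k Letter.two

/-- The edges `w ↗ w'` of the Young--Fibonacci lattice. -/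
inductive Edge : FibWord → FibWord → Prop where
  | prependOne (w : FibWord) : Edge w (Letter.one :: w)
  | oneToTwo (k : ℕ) (v : FibWord) :
      Edge (twos k ++ Letter.one :: v) (twos (k + 1) ++ v)
  | insertOne (k l : ℕ) (v : FibWord) (hl : 1 ≤ l) (hlk : l ≤ k) :
      Edge (twos k ++ v) (twos l ++ Letter.one :: (twos (k - l) ++ v))

/-- The set of saturated chains (oriented paths) from the empty word to `w`. -/
def saturatedChains (w : FibWord) : Set (List FibWord) :=
  {c | c.head? = some [] ∧ c.getLast? = some w ∧ c.IsChain Edge}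

/-- `dim w`, the number of saturated chains from the empty word to `w`. -/
noncomputable def dim (w : FibWord) : ℕ := (saturatedChains w).ncard

/-- The Plancherel harmonic function `dim w / |w|!`. -/
noncomputable def plancherel (w : FibWord) : ℝ := (dim w : ℝ) / ((weight w).factorial : ℝ)

/-! ### Clone Schur functions

A sequence `x₁, x₂, …` is a function `x : ℕ → ℝ` whose value at `0` is never used. -/

/-- The shifted sequence `x₁₊ₘ, x₂₊ₘ, …`. -/
def shift (x : ℕ → ℝ) (m : ℕ) : ℕ → ℝ := fun k => x (k + m)

/-- The `l × l` tridiagonal matrix with diagonal `x₁, x₂, …`, superdiagonal `y₁, y₂, …` and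
subdiagonal `1, 1, …`. -/
def matrixA (x y : ℕ → ℝ) (l : ℕ) : Matrix (Fin l) (Fin l) ℝ :=
  Matrix.of fun i j =>
    if j.val = i.val then x (i.val + 1)
    else if j.val = i.val + 1 then y (i.val + 1)
    else if i.val = j.val + 1 then 1
    else 0

/-- The `l × l` tridiagonal matrix with diagonal `y₁, x₃, x₄, …`, superdiagonal
`x₁ y₂, y₃, y₄, …` and subdiagonal `1, 1, …`. -/
def matrixB (x y : ℕ → ℝ) (l : ℕ) : Matrix (Fin l) (Fin l) ℝ :=
  Matrix.of fun i j =>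
    if j.val = i.val then (if i.val = 0 then y 1 else x (i.val + 2))
    else if j.val = i.val + 1 then (if i.val = 0 then x 1 * y 2 else y (i.val + 2))
    else if i.val = j.val + 1 then 1
    else 0

/-- `A_k(x | y)`, a determinant of size `k`. -/
noncomputable def detA (x y : ℕ → ℝ) (k : ℕ) : ℝ := (matrixA x y k).det

/-- `B_k(x | y)`, a determinant of size `k + 1`. -/
noncomputable def detB (x y : ℕ → ℝ) (k : ℕ) : ℝ := (matrixB x y (k + 1)).det

/-- The clone Schur function of the word `1^k w`. -/
noncomputable def cloneSchurAux (x y : ℕ → ℝ) : ℕ → FibWord → ℝ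
  | k, [] => detA x y k
  | k, Letter.one :: w => cloneSchurAux x y (k + 1) w
  | k, Letter.two :: u =>
      detB (shift x (weight u)) (shift y (weight u)) k * cloneSchurAux x y 0 u

/-- The biserial clone Schur function `s_w(x | y)`: it is `A_k(x | y)` for `w = 1^k`, and
`B_k(x + |u| | y + |u|) * s_u(x | y)` for `w = 1^k 2 u`. -/
noncomputable def cloneSchur (x y : ℕ → ℝ) (w : FibWord) : ℝ := cloneSchurAux x y 0 w

/-- The clone harmonic function `s_w(x | y) / (x₁ ⋯ x_{|w|})`. -/
noncomputable def cloneHarmonic (x y : ℕ → ℝ) (w : FibWord) : ℝ :=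
  cloneSchur x y w / ∏ k ∈ Finset.Icc 1 (weight w), x k

/-! ### Tableaux and the Robinson--Schensted insertion tableau -/

/-- A column of a Young--Fibonacci tableau with its entries. -/
inductive Column where
  | single (a : ℕ) : Column
  | double (bottom top : ℕ) : Column

/-- A tableau is the list of its columns, from left to right. -/
abbrev Tableau := List Column

/-- The height of a column, as a letter. -/
def Column.height : Column → Letter
  | Column.single _ => Letter.one
  | Column.double _ _ => Letter.two

/-- The shape of a tableau. -/
def shape (T : Tableau) : FibWord := T.map Column.height

/-- The maximal entry of the list `a :: l`. -/
def maxEntry (a : ℕ) (l : List ℕ) : ℕ := l.foldr max a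

/-- The matching procedure, on the list of the entries that are still unmatched, **listed from
right to left**: the rightmost unmatched entry `a` is matched with the maximal unmatched
entry `m` at its place or to its left. If `m = a`, this gives a column of height one, otherwise a
column of height two with the larger entry `m` on top. -/
def matchColumns : List ℕ → Tableau
  | [] => []
  | a :: l =>
      if maxEntry a l = a then Column.single a :: matchColumns l
      else Column.double a (maxEntry a l) :: matchColumns (l.erase (maxEntry a l))
termination_by l => l.length
decreasing_by
  · simp
  · have := List.length_erase_le (a := maxEntry a l) (l := l)
    simp only [List.length_cons]
    omega

/-- The one-line notation `s₁, …, sₙ` of a permutation, with entries in `{1, …, n}`. -/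
def oneLine {n : ℕ} (s : Equiv.Perm (Fin n)) : List ℕ :=
  List.ofFn fun i => (s i).val + 1

/-- The insertion tableau `P(s)` of the Young--Fibonacci Robinson--Schensted correspondence. -/
def insertionTableau {n : ℕ} (s : Equiv.Perm (Fin n)) : Tableau :=
  matchColumns (oneLine s).reverse

/-- The sliding step of the elimination map: `a` is a bottom entry which has lost its top entry,
and stands to the left of the given columns. If the top entry `c` of the next column exceeds `a`,
it moves on top of `a`, and the sliding continues with the entry below `c`, if there is one. -/
def slide : ℕ → Tableau → Tableau
  | a, [] => [Column.single a]
  | a, Column.single c :: T =>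
      if a < c then Column.double a c :: T else Column.single a :: Column.single c :: T
  | a, Column.double b c :: T =>
      if a < c then Column.double a c :: slide b T
      else Column.single a :: Column.double b c :: T

/-- The elimination map: remove the largest entry, which is the top entry of the leftmost
column, and slide. -/
def eliminate : Tableau → Tableau
  | [] => []
  | Column.single _ :: T => T
  | Column.double a _ :: T => slide a T

/-! ### Cotransition probabilities and random involutions -/

open Classical in
/-- The cotransition probabilities from `w` to `v` associated with a function `φ`: they are `0`
unless `v ↗ w`, and for `v ↗ w` they are `1` if `w = 1v`, and `φ v / φ u` if `w = 2u`. -/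
noncomputable def cotransition (φ : FibWord → ℝ) (w v : FibWord) : ℝ :=
  if Edge v w then
    match w with
    | [] => 0
    | Letter.one :: _ => 1
    | Letter.two :: u => φ v / φ u
  else 0

/-- The cotransition probability of the saturated chain of a tableau `T`, that is of the
chain of the shapes of `T` and its successive images under the elimination map. -/
noncomputable def chainCotransition (φ : FibWord → ℝ) (T : Tableau) : ℝ :=
  ∏ j ∈ Finset.range (weight (shape T)),
    cotransition φ (shape (eliminate^[j] T)) (shape (eliminate^[j + 1] T))

/-- The weight `ν_n(s | π, φ) = dim(w) π(w) μ_CT^φ(P(s))` of an involution `s`, with `w` the shape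
of `P(s)`. -/
noncomputable def nu (n : ℕ) (π φ : FibWord → ℝ) (s : Equiv.Perm (Fin n)) : ℝ :=
  (dim (shape (insertionTableau s)) : ℝ) * π (shape (insertionTableau s)) *
    chainCotransition φ (insertionTableau s)

/-- The involutions in the symmetric group (the identity included). -/
def involutions (n : ℕ) : Finset (Equiv.Perm (Fin n)) :=
  Finset.univ.filter fun s => s * s = 1

/-- The number of two-cycles of a permutation. -/
def numTwoCycles {n : ℕ} (s : Equiv.Perm (Fin n)) : ℕ := s.cycleType.count 2

/-- The shifted Plancherel specialization `x_k = y_k = k + σ - 1`. -/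
def shiftedPlancherel (σ : ℝ) : ℕ → ℝ := fun k => (k : ℝ) + σ - 1

/-- The distribution `ν_n` for the clone harmonic function of the shifted Plancherel
specialization and the Plancherel harmonic function. -/
noncomputable def nuShifted (σ : ℝ) (n : ℕ) (s : Equiv.Perm (Fin n)) : ℝ :=
  nu n (cloneHarmonic (shiftedPlancherel σ) (shiftedPlancherel σ)) plancherel s

/-- `G_n(σ)`, the expected number of two-cycles of a random involution. -/
noncomputable def expectedTwoCycles (σ : ℝ) (n : ℕ) : ℝ :=
  ∑ s ∈ involutions n, nuShifted σ n s * (numTwoCycles s : ℝ)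

end YoungFibonacci

/-! Both claims reduce to the shape of `P(s)`. Insertion matches involutions with standard tableaux:
a fixed point gives a column of height one and a two-cycle a column of height two
(`sum_involutionsOn_matchColumns`, `numTwoCycles_eq`). For a positive harmonic `φ`, the cotransition
products over the standard tableaux of one shape add up to 1 (`tableauSum_chainCotransition`),
because sliding a new entry into the tableaux of shape `u` yields each standard tableau of each
cover of `u` once (`sum_tableauSum_slide`). Hence the shape has law `dim w * cloneHarmonic w`, and
the two-cycles count its letters 2.

For the shifted Plancherel specialization `B_k` does not depend on `k`, so leading ones affect the
clone Schur function only on words without a 2. Splitting words of weight `n + 2` by their first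
letter gives total mass `c n = σ(σ+1)⋯(σ+n-1)`, and for the unnormalized moment the recurrence `T
(n+2) = T (n+1) + (n+1)(σ+n)(c n + T n)`.

After division by `c (n+2)`, the errors `e n = T n / c n - n/(σ+1)` satisfy `(σ+n+1) e (n+2) = e
(n+1) + (n+1) e n - σ/(σ+1)`. As `σ ≥ 1`, they are bounded by harmonic numbers, which are `o(n)`. -/

namespace YoungFibonacci

/-! ### The covering relation as a recursive list -/

/-- The words covering a given word in the Young--Fibonacci lattice. -/
def covers : FibWord → List FibWord
  | [] => [[Letter.one]]
  | Letter.one :: u => [Letter.one :: Letter.one :: u, Letter.two :: u]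
  | Letter.two :: u => (Letter.one :: Letter.two :: u) :: (covers u).map (Letter.two :: ·)

@[simp] lemma weight_nil : weight [] = 0 := rfl

@[simp] lemma weight_one_cons (u : FibWord) : weight (Letter.one :: u) = weight u + 1 := by
  simp [weight, Letter.val, add_comm]

@[simp] lemma weight_two_cons (u : FibWord) : weight (Letter.two :: u) = weight u + 2 := by
  simp [weight, Letter.val, add_comm]

lemma twos_zero : twos 0 = [] := rfl

lemma twos_succ (k : ℕ) : twos (k + 1) = Letter.two :: twos k := rfl

lemma one_cons_mem_covers (u : FibWord) : Letter.one :: u ∈ covers u := by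
  rcases u with _ | ⟨_ | _, u⟩ <;> simp [covers]

lemma Edge.mem_covers {u v : FibWord} (h : Edge u v) : v ∈ covers u := by
  induction h with
  | prependOne w => exact one_cons_mem_covers w
  | oneToTwo k v =>
    induction k with
    | zero => simp [twos, covers]
    | succ k ih => simpa [twos_succ, covers] using ih
  | insertOne k l v hl hlk =>
    induction l generalizing k with
    | zero => omega
    | succ l ih =>
      obtain ⟨k, rfl⟩ : ∃ m, k = m + 1 := ⟨k - 1, by omega⟩
      simp only [twos_succ, List.cons_append, covers, Nat.add_sub_add_right, List.mem_cons,
        List.mem_map]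
      right
      refine ⟨_, ?_, rfl⟩
      rcases l with _ | l
      · simpa [twos_zero] using one_cons_mem_covers _
      · exact ih k (by omega) (by omega)

/-- A prepended 1 becomes an insertion with `k = l = 1`; in the other two families the parameters
grow by one. -/
lemma Edge.two_cons {u v : FibWord} (h : Edge u v) : Edge (Letter.two :: u) (Letter.two :: v) := by
  cases h with
  | prependOne w => exact Edge.insertOne 1 1 u le_rfl le_rfl
  | oneToTwo k v => exact Edge.oneToTwo (k + 1) v
  | insertOne k l v hl hlk =>
    have := Edge.insertOne (k + 1) (l + 1) v (by omega) (by omega)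
    simpa [twos_succ] using this

lemma edge_of_mem_covers {u v : FibWord} (h : v ∈ covers u) : Edge u v := by
  induction u generalizing v with
  | nil =>
    obtain rfl : v = [Letter.one] := by simpa [covers] using h
    exact Edge.prependOne []
  | cons c u ih =>
    cases c with
    | one =>
      rcases (by simpa [covers] using h : v = _ ∨ v = _) with rfl | rfl
      · exact Edge.prependOne _
      · exact Edge.oneToTwo 0 u
    | two =>
      rcases List.mem_cons.1 h with rfl | h
      · exact Edge.prependOne _
      · obtain ⟨w, hw, rfl⟩ := List.mem_map.1 h
        exact (ih hw).two_cons

lemma edge_iff_mem_covers {u v : FibWord} : Edge u v ↔ v ∈ covers u :=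
  ⟨Edge.mem_covers, edge_of_mem_covers⟩

lemma one_cons_mem_covers_iff {u v : FibWord} : Letter.one :: u ∈ covers v ↔ v = u := by
  rcases v with _ | ⟨_ | _, v⟩ <;> simp [covers, eq_comm]

lemma weight_of_mem_covers {u v : FibWord} (h : v ∈ covers u) : weight v = weight u + 1 := by
  induction u generalizing v with
  | nil => simp_all [covers]
  | cons c u ih =>
    cases c with
    | one => rcases (by simpa [covers] using h : v = _ ∨ v = _) with rfl | rfl <;> simp
    | two =>
      rcases List.mem_cons.1 h with rfl | h
      · simp
      · obtain ⟨w, hw, rfl⟩ := List.mem_map.1 h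
        simp [ih hw]

/-- This reflection identifies the predecessors of `2u` with the covers of `u`; the recursion for
`dim` and the nonvanishing of the cotransition probabilities along eliminations rest on it. -/
lemma two_cons_mem_covers_iff {u v : FibWord} : Letter.two :: u ∈ covers v ↔ v ∈ covers u := by
  induction v generalizing u with
  | nil => rcases u with _ | ⟨_ | _, u⟩ <;> simp [covers]
  | cons c v ih =>
    cases c with
    | one => rcases u with _ | ⟨_ | _, u⟩ <;> simp [covers, eq_comm]
    | two =>
      rcases u with _ | ⟨_ | _, u⟩
      · simpa [covers] using fun h => by simpa using weight_of_mem_covers h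
      · simp [covers, one_cons_mem_covers_iff]
      · simp [covers, ih]

lemma nodup_covers (u : FibWord) : (covers u).Nodup := by
  induction u with
  | nil => simp [covers]
  | cons c u ih =>
    cases c with
    | one => simp [covers]
    | two => simp [covers, ih.map (List.cons_injective)]

/-! ### The dimension -/

lemma mem_saturatedChains_concat {w v : FibWord} {c : List FibWord} :
    c ++ [v] ∈ saturatedChains w ↔
      v = w ∧ ((c = [] ∧ w = []) ∨ ∃ u, Edge u w ∧ c ∈ saturatedChains u) := by
  rcases List.eq_nil_or_concat c with rfl | ⟨c, u, rfl⟩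
  · simp only [saturatedChains, Set.mem_ofPred_eq]
    simp
    aesop
  · simp only [saturatedChains, Set.mem_ofPred_eq, List.concat_eq_append, List.isChain_append]
    simp
    constructor
    · rintro ⟨h1, rfl, h2, h3⟩
      simp_all
    · rintro ⟨rfl, h⟩
      simp_all

lemma saturatedChains_nil : saturatedChains [] = {[[]]} := by
  ext c
  rcases List.eq_nil_or_concat c with rfl | ⟨c, u, rfl⟩
  · simp [saturatedChains]
  · rw [List.concat_eq_append, mem_saturatedChains_concat]
    have : ∀ u, ¬ Edge u [] := fun u h => by simpa using weight_of_mem_covers h.mem_covers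
    simp only [this, false_and, exists_false, or_false, and_true, Set.mem_singleton_iff]
    constructor
    · rintro ⟨rfl, rfl⟩
      rfl
    · intro h
      have := congrArg List.length h
      obtain rfl : c = [] := by simpa using this
      simpa using h

lemma saturatedChains_eq_biUnion {w : FibWord} (hw : w ≠ []) :
    saturatedChains w = ⋃ u ∈ {u | Edge u w}, (· ++ [w]) '' saturatedChains u := by
  ext c
  rcases List.eq_nil_or_concat c with rfl | ⟨c, u, rfl⟩
  · simp [saturatedChains]
  · rw [List.concat_eq_append, mem_saturatedChains_concat]
    simp [hw]
    aesop

lemma dim_nil : dim [] = 1 := by simp [dim, saturatedChains_nil]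

lemma eq_of_mem_saturatedChains {c : List FibWord} {u v : FibWord} (hu : c ∈ saturatedChains u)
    (hv : c ∈ saturatedChains v) : u = v := by
  have := hu.2.1.symm.trans hv.2.1
  simpa using this

/-- Chains are partitioned by their penultimate word. Finiteness is proved alongside because `ncard`
is additive here only over finite sets. -/
lemma dim_eq_sum (w : FibWord) (hw : w ≠ []) (l : List FibWord) (hl : l.Nodup)
    (h : ∀ u, Edge u w ↔ u ∈ l) (hfin : ∀ u ∈ l, (saturatedChains u).Finite) :
    (saturatedChains w).Finite ∧ dim w = (l.map dim).sum := by
  classical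
  have hinj : Function.Injective (· ++ [w] : List FibWord → List FibWord) :=
    fun a b h => by simpa using h
  have hset : {u | Edge u w} = (l.toFinset : Set FibWord) := by ext u; simp [h]
  have hs := saturatedChains_eq_biUnion hw
  rw [hset] at hs
  have hf : ∀ u ∈ (l.toFinset : Set FibWord), ((· ++ [w]) '' saturatedChains u).Finite :=
    fun u hu => (hfin u (by simpa using hu)).image _
  refine ⟨hs ▸ Set.Finite.biUnion (Finset.finite_toSet _) hf, ?_⟩
  rw [dim, hs, Set.Finite.ncard_biUnion (Finset.finite_toSet _) hf, finsum_mem_coe_finset,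
    ← List.sum_toFinset _ hl]
  · exact Finset.sum_congr rfl fun u _ => Set.ncard_image_of_injective _ hinj
  · intro u _ v _ huv
    refine Set.disjoint_left.2 ?_
    rintro _ ⟨c, hc, rfl⟩ ⟨c', hc', h'⟩
    obtain rfl := hinj h'
    exact huv (eq_of_mem_saturatedChains hc hc')

lemma finite_saturatedChains (w : FibWord) : (saturatedChains w).Finite := by
  induction hn : weight w using Nat.strong_induction_on generalizing w with
  | _ n ih =>
    subst hn
    rcases w with _ | ⟨_ | _, u⟩
    · simp [saturatedChains_nil]
    · exact (dim_eq_sum (Letter.one :: u) (by simp) [u] (by simp)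
        (fun v => by simp [edge_iff_mem_covers, one_cons_mem_covers_iff])
        (fun v hv => ih _ (by simp_all) v rfl)).1
    · exact (dim_eq_sum (Letter.two :: u) (by simp) (covers u) (nodup_covers u)
        (fun v => by rw [edge_iff_mem_covers, two_cons_mem_covers_iff])
        (fun v hv => ih _ (by simp [weight_of_mem_covers hv]) v rfl)).1

lemma dim_one_cons (u : FibWord) : dim (Letter.one :: u) = dim u := by
  simpa using (dim_eq_sum (Letter.one :: u) (by simp) [u] (by simp)
    (fun v => by simp [edge_iff_mem_covers, one_cons_mem_covers_iff])
    (fun v _ => finite_saturatedChains v)).2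

lemma dim_two_cons_eq_sum (u : FibWord) :
    dim (Letter.two :: u) = ((covers u).map dim).sum :=
  (dim_eq_sum (Letter.two :: u) (by simp) (covers u) (nodup_covers u)
    (fun v => by rw [edge_iff_mem_covers, two_cons_mem_covers_iff])
    (fun v _ => finite_saturatedChains v)).2

/-- For `u = 2u'` the covers are `12u'` and the `2v` with `v` covering `u'`. By induction each `2v`
contributes `(|u'| + 2) dim v`, and these `dim v` add up to `dim (2u')`. -/
lemma dim_two_cons (u : FibWord) : dim (Letter.two :: u) = (weight u + 1) * dim u := by
  induction hn : weight u using Nat.strong_induction_on generalizing u with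
  | _ n ih =>
    subst hn
    rw [dim_two_cons_eq_sum]
    rcases u with _ | ⟨_ | _, u⟩
    · simp [covers, dim_one_cons]
    · have := ih (weight u) (by simp) u rfl
      simp only [covers, List.map_cons, List.map_nil, List.sum_cons, List.sum_nil, dim_one_cons,
        this, weight_one_cons]
      ring
    · have hu := ih (weight u) (by simp) u rfl
      have h : ∀ v ∈ covers u, (dim ∘ (Letter.two :: ·)) v = (weight u + 2) * dim v :=
        fun v hv => by simpa [weight_of_mem_covers hv] using ih _ (by
          simp [weight_of_mem_covers hv]) v rfl
      rw [covers, List.map_cons, List.map_map, List.map_congr_left h, List.sum_cons,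
        List.sum_map_mul_left, dim_one_cons, ← dim_two_cons_eq_sum, hu, weight_two_cons]
      ring

lemma sum_dim_covers (u : FibWord) : ((covers u).map dim).sum = (weight u + 1) * dim u := by
  rw [← dim_two_cons_eq_sum, dim_two_cons]

lemma dim_pos (u : FibWord) : 0 < dim u := by
  induction u with
  | nil => simp [dim_nil]
  | cons c u ih =>
    cases c with
    | one => rwa [dim_one_cons]
    | two => rw [dim_two_cons]; positivity

lemma plancherel_pos (u : FibWord) : 0 < plancherel u := by
  have := dim_pos u
  unfold plancherel
  positivity

/-- Harmonicity of the Plancherel function: the factor `|u| + 1` from `sum_dim_covers` cancels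
against the factorials. -/
lemma sum_plancherel_covers (u : FibWord) :
    ((covers u).map plancherel).sum = plancherel u := by
  have h : ∀ v ∈ covers u, plancherel v = (dim v : ℝ) * ((weight u + 1).factorial : ℝ)⁻¹ := by
    intro v hv
    rw [plancherel, weight_of_mem_covers hv, div_eq_mul_inv]
  rw [List.map_congr_left h, List.sum_map_mul_right, plancherel, Nat.factorial_succ]
  have := congrArg (Nat.cast (R := ℝ)) (sum_dim_covers u)
  rw [Nat.cast_list_sum, List.map_map] at this
  change (List.map (fun v => (dim v : ℝ)) _).sum = _ at this
  rw [this]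
  push_cast
  field_simp

/-! ### Tridiagonal determinants -/

/-- The tridiagonal matrix with given diagonal and superdiagonal, and with subdiagonal
`1, 1, …`. -/
def tridiagonal (d e : ℕ → ℝ) (n : ℕ) : Matrix (Fin n) (Fin n) ℝ :=
  Matrix.of fun i j =>
    if j.val = i.val then d i.val
    else if j.val = i.val + 1 then e i.val
    else if i.val = j.val + 1 then 1
    else 0

lemma det_tridiagonal_zero (d e : ℕ → ℝ) : (tridiagonal d e 0).det = 1 := by simp

lemma det_tridiagonal_one (d e : ℕ → ℝ) : (tridiagonal d e 1).det = d 0 := by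
  simp [tridiagonal]

/-- In the expansion along the first row only two minors survive, and the first column of the second
minor has a single nonzero entry, 1. -/
lemma det_tridiagonal_succ_succ (d e : ℕ → ℝ) (n : ℕ) :
    (tridiagonal d e (n + 2)).det =
      d 0 * (tridiagonal (fun i => d (i + 1)) (fun i => e (i + 1)) (n + 1)).det -
        e 0 * (tridiagonal (fun i => d (i + 2)) (fun i => e (i + 2)) n).det := by
  rw [Matrix.det_succ_row_zero, Fin.sum_univ_succ, Fin.sum_univ_succ, Finset.sum_eq_zero]
  · have h1 : (tridiagonal d e (n + 2)).submatrix Fin.succ (Fin.succAbove 0) =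
        tridiagonal (fun i => d (i + 1)) (fun i => e (i + 1)) (n + 1) := by
      ext i j
      simp [tridiagonal]
    have h2 : ((tridiagonal d e (n + 2)).submatrix Fin.succ (Fin.succAbove 1)).det =
        (tridiagonal (fun i => d (i + 2)) (fun i => e (i + 2)) n).det := by
      rw [Matrix.det_succ_column_zero, Fin.sum_univ_succ, Finset.sum_eq_zero]
      · have : ((tridiagonal d e (n + 2)).submatrix Fin.succ (Fin.succAbove 1)).submatrix
            (Fin.succAbove 0) Fin.succ =
            tridiagonal (fun i => d (i + 2)) (fun i => e (i + 2)) n := by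
          ext i j
          simp [tridiagonal, Fin.succAbove, Fin.lt_def]
        rw [this]
        simp [tridiagonal]
      · intro i _
        simp [tridiagonal]
    rw [Fin.succ_zero_eq_one, h1, h2]
    simp [tridiagonal]
    ring
  · intro i _
    simp [tridiagonal]

/-- The three-term recurrence from the expansion along the last row. -/
lemma det_tridiagonal_last (d e : ℕ → ℝ) (n : ℕ) :
    (tridiagonal d e (n + 2)).det =
      d (n + 1) * (tridiagonal d e (n + 1)).det - e n * (tridiagonal d e n).det := by
  have h1 : ∀ d e : ℕ → ℝ, (tridiagonal d e (0 + 1)).det = d 0 := det_tridiagonal_one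
  induction n using Nat.twoStepInduction generalizing d e with
  | zero =>
    rw [det_tridiagonal_succ_succ]
    simp only [h1, det_tridiagonal_zero]
    ring
  | one =>
    rw [det_tridiagonal_succ_succ, det_tridiagonal_succ_succ d e 0,
      det_tridiagonal_succ_succ (fun i => d (i + 1)) _ 0]
    simp only [h1, det_tridiagonal_zero]
    ring
  | more n ih1 ih2 =>
    -- Expansions at the two ends commute: expand at the front, apply the hypotheses to the shifted
    -- sequences, and reassemble.
    rw [det_tridiagonal_succ_succ d e (n + 2), ih2 (fun i => d (i + 1)),
      ih1 (fun i => d (i + 2)), det_tridiagonal_succ_succ d e (n + 1),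
      det_tridiagonal_succ_succ d e n]
    ring

/-! ### The shifted Plancherel specialization -/

lemma shift_shiftedPlancherel (σ : ℝ) (m : ℕ) :
    shift (shiftedPlancherel σ) m = shiftedPlancherel (σ + m) := by
  ext k
  simp only [shift, shiftedPlancherel]
  push_cast
  ring

/-- The first two determinants equal `t`. From then on the diagonal entry exceeds the preceding
superdiagonal entry by 1, so the last-row recurrence preserves the constant value. -/
lemma detB_shiftedPlancherel (t : ℝ) (k : ℕ) :
    detB (shiftedPlancherel t) (shiftedPlancherel t) k = t := by
  have h : ∀ l, matrixB (shiftedPlancherel t) (shiftedPlancherel t) l =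
      tridiagonal (fun i => if i = 0 then t else t + i + 1)
        (fun i => if i = 0 then t * (t + 1) else t + i + 1) l := by
    intro l
    ext i j
    simp only [matrixB, tridiagonal, shiftedPlancherel, Matrix.of_apply]
    push_cast
    congr 1
    · congr 1 <;> ring
    · congr 2 <;> ring
  rw [detB, h]
  induction k using Nat.twoStepInduction with
  | zero =>
    rw [zero_add, det_tridiagonal_one]
    simp
  | one =>
    rw [det_tridiagonal_last, zero_add, det_tridiagonal_one, det_tridiagonal_zero]
    simp
    ring
  | more n ih1 ih2 =>
    rw [det_tridiagonal_last, ih2, ih1]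
    simp
    ring

/-- The rising factorial `σ (σ + 1) ⋯ (σ + n - 1)`. -/
def risingProd (σ : ℝ) (n : ℕ) : ℝ := ∏ k ∈ Finset.range n, (σ + k)

lemma risingProd_succ (σ : ℝ) (n : ℕ) : risingProd σ (n + 1) = risingProd σ n * (σ + n) :=
  Finset.prod_range_succ _ _

lemma risingProd_pos {σ : ℝ} (hσ : 0 < σ) (n : ℕ) : 0 < risingProd σ n :=
  Finset.prod_pos fun _ _ => by positivity

lemma prod_shiftedPlancherel (σ : ℝ) (n : ℕ) :
    ∏ k ∈ Finset.Icc 1 n, shiftedPlancherel σ k = risingProd σ n := by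
  induction n with
  | zero => simp [risingProd]
  | succ n ih =>
    rw [Finset.prod_Icc_succ_top (by omega), ih, risingProd_succ, shiftedPlancherel]
    push_cast
    ring

/-- The last-row recurrence multiplies the difference of consecutive determinants by `σ + k`, and
the first difference is `σ - 1`. -/
lemma detA_shiftedPlancherel_succ (σ : ℝ) (k : ℕ) :
    detA (shiftedPlancherel σ) (shiftedPlancherel σ) (k + 1) =
      detA (shiftedPlancherel σ) (shiftedPlancherel σ) k + (σ - 1) * risingProd σ k := by
  have h : ∀ l, matrixA (shiftedPlancherel σ) (shiftedPlancherel σ) l =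
      tridiagonal (fun i => σ + i) (fun i => σ + i) l := by
    intro l
    ext i j
    simp only [matrixA, tridiagonal, shiftedPlancherel, Matrix.of_apply]
    push_cast
    congr 1
    · ring
    · congr 1; ring
  simp only [detA, h]
  induction k with
  | zero =>
    rw [zero_add, det_tridiagonal_one, det_tridiagonal_zero]
    simp [risingProd]
  | succ n ih =>
    rw [det_tridiagonal_last, risingProd_succ]
    push_cast
    linear_combination (σ + n) * ih

lemma detA_shiftedPlancherel_zero (σ : ℝ) :
    detA (shiftedPlancherel σ) (shiftedPlancherel σ) 0 = 1 := by simp [detA]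

lemma detA_shiftedPlancherel_pos {σ : ℝ} (hσ : 1 ≤ σ) (k : ℕ) :
    0 < detA (shiftedPlancherel σ) (shiftedPlancherel σ) k := by
  induction k with
  | zero => simp [detA_shiftedPlancherel_zero]
  | succ k ih =>
    rw [detA_shiftedPlancherel_succ]
    have := risingProd_pos (by linarith : 0 < σ) k
    have : 0 ≤ (σ - 1) * risingProd σ k := mul_nonneg (by linarith) this.le
    linarith

/-! ### Clone Schur functions of the shifted Plancherel specialization -/

/-- The number of letters `2` of a word. -/
def numTwos : FibWord → ℕ
  | [] => 0
  | Letter.one :: u => numTwos u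
  | Letter.two :: u => numTwos u + 1

/-- The clone Schur function at the shifted Plancherel specialization. -/
noncomputable def schurShifted (σ : ℝ) (w : FibWord) : ℝ :=
  cloneSchur (shiftedPlancherel σ) (shiftedPlancherel σ) w

lemma schurShifted_nil (σ : ℝ) : schurShifted σ [] = 1 := by
  simp [schurShifted, cloneSchur, cloneSchurAux, detA_shiftedPlancherel_zero]

lemma schurShifted_two_cons (σ : ℝ) (u : FibWord) :
    schurShifted σ (Letter.two :: u) = (σ + weight u) * schurShifted σ u := by
  simp [schurShifted, cloneSchur, cloneSchurAux, shift_shiftedPlancherel, detB_shiftedPlancherel]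

lemma cloneSchurAux_shiftedPlancherel_pos {σ : ℝ} (hσ : 1 ≤ σ) (k : ℕ) (w : FibWord) :
    0 < cloneSchurAux (shiftedPlancherel σ) (shiftedPlancherel σ) k w := by
  induction w generalizing k with
  | nil => exact detA_shiftedPlancherel_pos hσ k
  | cons c w ih =>
    cases c with
    | one => exact ih _
    | two =>
      rw [cloneSchurAux, shift_shiftedPlancherel, detB_shiftedPlancherel]
      have := ih 0
      positivity

lemma schurShifted_pos {σ : ℝ} (hσ : 1 ≤ σ) (w : FibWord) : 0 < schurShifted σ w :=
  cloneSchurAux_shiftedPlancherel_pos hσ 0 w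

/-- If a 2 occurs, the number of leading ones enters only through `detB`, which is independent of
it; otherwise the increment is that of `detA`. -/
lemma cloneSchurAux_shiftedPlancherel_succ (σ : ℝ) (k : ℕ) (w : FibWord) :
    cloneSchurAux (shiftedPlancherel σ) (shiftedPlancherel σ) (k + 1) w =
      cloneSchurAux (shiftedPlancherel σ) (shiftedPlancherel σ) k w +
        if numTwos w = 0 then (σ - 1) * risingProd σ (k + weight w) else 0 := by
  induction w generalizing k with
  | nil => simp [cloneSchurAux, numTwos, detA_shiftedPlancherel_succ]
  | cons c w ih =>
    cases c with
    | one =>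
      rw [cloneSchurAux, cloneSchurAux, ih (k + 1), numTwos, weight_one_cons, add_assoc k 1,
        add_comm 1]
    | two =>
      simp [cloneSchurAux, shift_shiftedPlancherel, detB_shiftedPlancherel, numTwos]

lemma schurShifted_one_cons (σ : ℝ) (u : FibWord) :
    schurShifted σ (Letter.one :: u) = schurShifted σ u +
      if numTwos u = 0 then (σ - 1) * risingProd σ (weight u) else 0 := by
  simpa [schurShifted, cloneSchur, cloneSchurAux] using
    cloneSchurAux_shiftedPlancherel_succ σ 0 u

/-! ### Sums over words of given weight -/

/-- The words of weight `n`. -/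
def words : ℕ → List FibWord
  | 0 => [[]]
  | 1 => [[Letter.one]]
  | n + 2 => (words (n + 1)).map (Letter.one :: ·) ++ (words n).map (Letter.two :: ·)

lemma weight_of_mem_words {n : ℕ} {w : FibWord} (h : w ∈ words n) : weight w = n := by
  induction n using Nat.twoStepInduction generalizing w with
  | zero => simp_all [words]
  | one => simp_all [words]
  | more n ih1 ih2 =>
    rcases (by simpa [words] using h :
      (∃ u ∈ words (n + 1), _ = w) ∨ ∃ u ∈ words n, _ = w) with ⟨u, hu, rfl⟩ | ⟨u, hu, rfl⟩
    · simp [ih2 hu]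
    · simp [ih1 hu]

lemma sum_words_succ_succ (n : ℕ) (f : FibWord → ℝ) :
    ((words (n + 2)).map f).sum =
      ((words (n + 1)).map fun u => f (Letter.one :: u)).sum +
        ((words n).map fun u => f (Letter.two :: u)).sum := by
  rw [words, List.map_append, List.sum_append, List.map_map, List.map_map]
  rfl

/-- Only `1^n` contributes, and it has dimension 1. -/
lemma sum_words_ite_numTwos (n : ℕ) (a : ℝ) :
    ((words n).map fun u => (dim u : ℝ) * if numTwos u = 0 then a else 0).sum = a := by
  induction n using Nat.twoStepInduction with
  | zero => simp [words, numTwos, dim_nil]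
  | one => simp [words, numTwos, dim_nil, dim_one_cons]
  | more n ih1 ih2 =>
    rw [sum_words_succ_succ]
    simp only [dim_one_cons, numTwos, Nat.add_eq_zero_iff, one_ne_zero, and_false, if_false,
      mul_zero, List.map_const', List.sum_replicate, smul_zero, add_zero]
    exact ih2

/-- The unnormalized total mass. -/
lemma sum_words_dim_mul_schurShifted (σ : ℝ) (n : ℕ) :
    ((words n).map fun w => (dim w : ℝ) * schurShifted σ w).sum = risingProd σ n := by
  induction n using Nat.twoStepInduction with
  | zero => simp [words, dim_nil, schurShifted_nil, risingProd]
  | one =>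
    simp [words, dim_nil, dim_one_cons, schurShifted_one_cons, schurShifted_nil, risingProd,
      numTwos]
  | more n ih1 ih2 =>
    have h1 : ∀ u ∈ words (n + 1), (dim (Letter.one :: u) : ℝ) * schurShifted σ (Letter.one :: u) =
        dim u * schurShifted σ u +
          dim u * if numTwos u = 0 then (σ - 1) * risingProd σ (n + 1) else 0 := by
      intro u hu
      rw [dim_one_cons, schurShifted_one_cons, weight_of_mem_words hu, mul_add]
    have h2 : ∀ u ∈ words n, (dim (Letter.two :: u) : ℝ) * schurShifted σ (Letter.two :: u) =
        ((n + 1) * (σ + n)) * (dim u * schurShifted σ u) := by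
      intro u hu
      rw [dim_two_cons, schurShifted_two_cons, weight_of_mem_words hu]
      push_cast
      ring
    -- With `c n = risingProd σ n`, words starting with 1 give `σ * c (n+1)`, including the
    -- correction from `1^(n+1)`; words starting with 2 give `(n+1) * c (n+1)`.
    rw [sum_words_succ_succ, List.map_congr_left h1, List.map_congr_left h2, List.sum_map_add,
      sum_words_ite_numTwos, List.sum_map_mul_left, ih1, ih2, risingProd_succ σ (n + 1), risingProd_succ σ n]
    push_cast
    ring

/-- The unnormalized expectation of the number of letters `2`. -/
noncomputable def twosMoment (σ : ℝ) (n : ℕ) : ℝ :=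
  ((words n).map fun w => (dim w : ℝ) * schurShifted σ w * numTwos w).sum

lemma twosMoment_zero (σ : ℝ) : twosMoment σ 0 = 0 := by simp [twosMoment, words, numTwos]

lemma twosMoment_one (σ : ℝ) : twosMoment σ 1 = 0 := by simp [twosMoment, words, numTwos]

lemma twosMoment_succ_succ (σ : ℝ) (n : ℕ) :
    twosMoment σ (n + 2) = twosMoment σ (n + 1) +
      (n + 1) * (σ + n) * (risingProd σ n + twosMoment σ n) := by
  have h1 : ∀ u ∈ words (n + 1),
      (dim (Letter.one :: u) : ℝ) * schurShifted σ (Letter.one :: u) * numTwos (Letter.one :: u) =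
        dim u * schurShifted σ u * numTwos u := by
    intro u _
    rw [dim_one_cons, schurShifted_one_cons, numTwos]
    -- The correction term lives on words without a 2, where the factor `numTwos` kills it.
    split_ifs with h <;> simp [h]
  have h2 : ∀ u ∈ words n,
      (dim (Letter.two :: u) : ℝ) * schurShifted σ (Letter.two :: u) * numTwos (Letter.two :: u) =
        ((n + 1) * (σ + n)) * (dim u * schurShifted σ u + dim u * schurShifted σ u * numTwos u) := by
    intro u hu
    rw [dim_two_cons, schurShifted_two_cons, weight_of_mem_words hu, numTwos]
    push_cast
    ring
  rw [twosMoment, sum_words_succ_succ, List.map_congr_left h1, List.map_congr_left h2,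
    List.sum_map_mul_left, List.sum_map_add, sum_words_dim_mul_schurShifted]
  rfl

/-! ### Asymptotics -/

lemma abs_twosMoment_sub_le {σ : ℝ} (hσ : 1 ≤ σ) (n : ℕ) :
    |twosMoment σ n / risingProd σ n - n / (σ + 1)| ≤
      ∑ k ∈ Finset.range n, 1 / ((k : ℝ) + 1) := by
  have hpos : 0 < σ + 1 := by linarith
  induction n using Nat.twoStepInduction with
  | zero => simp [twosMoment_zero]
  | one =>
    have : 0 < 1 / (σ + 1) := by positivity
    simp [twosMoment_one] at this ⊢
    rw [abs_of_pos hpos]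
    exact inv_le_one_of_one_le₀ (by linarith)
  | more n ih1 ih2 =>
    have hc := risingProd_pos (by linarith : 0 < σ) n
    set e0 := twosMoment σ n / risingProd σ n - n / (σ + 1) with he0
    set e1 := twosMoment σ (n + 1) / risingProd σ (n + 1) - (n + 1 : ℕ) / (σ + 1) with he1
    set e2 := twosMoment σ (n + 1 + 1) / risingProd σ (n + 1 + 1) - (n + 1 + 1 : ℕ) / (σ + 1)
      with he2
    have hσn : 0 < σ + n := by positivity
    have key : (σ + n + 1) * e2 = e1 + (n + 1) * e0 - σ / (σ + 1) := by
      rw [he2, he1, he0, twosMoment_succ_succ, risingProd_succ, risingProd_succ]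
      push_cast
      have : σ + (n + 1) ≠ 0 := by positivity
      field_simp
      ring
    have hS := Finset.sum_range_succ (fun k : ℕ => 1 / ((k : ℝ) + 1))
    have hq0 : 0 ≤ σ / (σ + 1) := by positivity
    have hq1 : σ / (σ + 1) ≤ 1 := by rw [div_le_one hpos]; linarith
    rw [hS]
    rw [hS] at ih2 ⊢
    set H := ∑ k ∈ Finset.range n, 1 / ((k : ℝ) + 1) with hH
    push_cast
    set p := 1 / ((n : ℝ) + 1) with hp
    have hp0 : 0 < p := by positivity
    set q := 1 / ((n : ℝ) + 1 + 1) with hq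
    -- The new harmonic term `q = 1/(n+2)` is just large enough to absorb `σ/(σ+1) ≤ 1` after
    -- multiplication by `n + 2`.
    have hq2 : (n + 2) * q = 1 := by rw [hq]; field_simp; ring
    have habs : (n + 2) * |e2| ≤ (n + 2) * (H + p + q) := by
      calc (n + 2) * |e2| ≤ (σ + n + 1) * |e2| := by gcongr ?_ * _; linarith
        _ = |(σ + n + 1) * e2| := by rw [abs_mul, abs_of_pos (by positivity : 0 < σ + n + 1)]
        _ = |e1 + (n + 1) * e0 - σ / (σ + 1)| := by rw [key]
        _ ≤ |e1| + |(n + 1) * e0| + |σ / (σ + 1)| := by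
          exact (abs_sub _ _).trans (by gcongr; exact abs_add_le _ _)
        _ ≤ (H + p) + (n + 1) * (H + p) + 1 := by
          rw [abs_mul, abs_of_pos (by positivity : (0 : ℝ) < n + 1), abs_of_nonneg hq0]
          gcongr
          linarith
        _ = _ := by linear_combination -hq2
    exact le_of_mul_le_mul_left habs (by positivity)

/-- The error bound divided by `n` is a Cesàro mean of `1/(k+1)`, hence tends to 0. -/
lemma tendsto_twosMoment {σ : ℝ} (hσ : 1 ≤ σ) :
    Tendsto (fun n : ℕ => twosMoment σ n / risingProd σ n / n) atTop (𝓝 (1 / (σ + 1))) := by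
  have h0 := (tendsto_one_div_add_atTop_nhds_zero_nat (𝕜 := ℝ)).cesaro
  have h1 : Tendsto (fun n : ℕ => twosMoment σ n / risingProd σ n / n - 1 / (σ + 1)) atTop
      (𝓝 0) := by
    refine squeeze_zero_norm' ?_ h0
    filter_upwards [eventually_gt_atTop 0] with n hn
    have hn' : (0 : ℝ) < n := by exact_mod_cast hn
    have : twosMoment σ n / risingProd σ n / n - 1 / (σ + 1) =
        (n : ℝ)⁻¹ * (twosMoment σ n / risingProd σ n - n / (σ + 1)) := by
      field_simp
    rw [this, Real.norm_eq_abs, abs_mul, abs_of_pos (by positivity : (0 : ℝ) < (n : ℝ)⁻¹)]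
    gcongr
    exact abs_twosMoment_sub_le hσ n
  simpa using h1.add_const (1 / (σ + 1))

/-! ### Sums over standard tableaux -/

lemma list_sum_map_finset_sum {ι κ : Type*} (l : List ι) (s : Finset κ) (f : ι → κ → ℝ) :
    (l.map fun i => ∑ k ∈ s, f i k).sum = ∑ k ∈ s, (l.map fun i => f i k).sum := by
  induction l with
  | nil => simp
  | cons i l ih => simp [ih, Finset.sum_add_distrib]

/-- The sum of `f` over the standard tableaux of shape `w` whose entries are the `i + 1` with
`i ∈ R`. These are the tableaux in which the top of every column is the largest of the entries
that are not further to the left. -/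
noncomputable def tableauSum {n : ℕ} :
    FibWord → Finset (Fin n) → (Tableau → ℝ) → ℝ
  | [], _, f => f []
  | Letter.one :: u, R, f =>
      if h : R.Nonempty then
        tableauSum u (R.erase (R.max' h)) fun T => f (Column.single ((R.max' h).val + 1) :: T)
      else 0
  | Letter.two :: u, R, f =>
      if h : R.Nonempty then
        ∑ a ∈ R.erase (R.max' h), tableauSum u ((R.erase (R.max' h)).erase a) fun T =>
          f (Column.double (a.val + 1) ((R.max' h).val + 1) :: T)
      else 0

section

variable {n : ℕ} {R : Finset (Fin n)} {M : Fin n}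

lemma tableauSum_one_cons (hM : IsGreatest (R : Set (Fin n)) M) (u : FibWord)
    (f : Tableau → ℝ) :
    tableauSum (Letter.one :: u) R f =
      tableauSum u (R.erase M) fun T => f (Column.single (M.val + 1) :: T) := by
  have hne : R.Nonempty := ⟨M, hM.1⟩
  obtain rfl : M = R.max' hne := hM.unique (R.isGreatest_max' hne)
  rw [tableauSum, dif_pos hne]

lemma tableauSum_two_cons (hM : IsGreatest (R : Set (Fin n)) M) (u : FibWord)
    (f : Tableau → ℝ) :
    tableauSum (Letter.two :: u) R f =
      ∑ a ∈ R.erase M, tableauSum u ((R.erase M).erase a) fun T =>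
        f (Column.double (a.val + 1) (M.val + 1) :: T) := by
  have hne : R.Nonempty := ⟨M, hM.1⟩
  obtain rfl : M = R.max' hne := hM.unique (R.isGreatest_max' hne)
  rw [tableauSum, dif_pos hne]

lemma tableauSum_congr {w : FibWord} {f g : Tableau → ℝ}
    (h : ∀ T, shape T = w → f T = g T) : tableauSum w R f = tableauSum w R g := by
  induction w generalizing R f g with
  | nil => exact h [] rfl
  | cons c u ih =>
    cases c with
    | one =>
      simp only [tableauSum]
      split_ifs with hR
      · exact ih fun T hT => h _ (by simp [← hT, shape, Column.height])
      · rfl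
    | two =>
      simp only [tableauSum]
      split_ifs with hR
      · exact Finset.sum_congr rfl fun a _ =>
          ih fun T hT => h _ (by simp [← hT, shape, Column.height])
      · rfl

lemma tableauSum_mul_left (w : FibWord) (c : ℝ) (f : Tableau → ℝ) :
    tableauSum w R (fun T => c * f T) = c * tableauSum w R f := by
  induction w generalizing R f with
  | nil => rfl
  | cons l u ih => cases l <;> simp [tableauSum, ih, Finset.mul_sum]

/-- Sliding a new entry into the standard tableaux of shape `u` gives every standard tableau of
every shape that covers `u` exactly once. -/
lemma sum_tableauSum_slide (u : FibWord) (R : Finset (Fin n)) (hR : R.card = weight u + 1)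
    (f : Tableau → ℝ) :
    ∑ a ∈ R, tableauSum u (R.erase a) (fun T => f (slide (a.val + 1) T)) =
      ((covers u).map fun v => tableauSum v R f).sum := by
  have hne : R.Nonempty := Finset.card_pos.1 (by omega)
  obtain ⟨M, hM⟩ : ∃ M, IsGreatest (R : Set (Fin n)) M := ⟨_, R.isGreatest_max' hne⟩
  have hlt : ∀ a ∈ R.erase M, a < M := fun a ha =>
    lt_of_le_of_ne (hM.2 (Finset.mem_of_mem_erase ha)) (Finset.ne_of_mem_erase ha)
  have hM' : ∀ a ∈ R.erase M, IsGreatest ((R.erase a : Finset (Fin n)) : Set (Fin n)) M :=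
    fun a ha => ⟨by simpa [(hlt a ha).ne'] using hM.1,
      fun b hb => hM.2 (Finset.mem_of_mem_erase hb)⟩
  have hcard : (R.erase M).card = weight u := by rw [Finset.card_erase_of_mem hM.1]; omega
  induction u generalizing R f M with
  | nil =>
    obtain ⟨a, rfl⟩ := Finset.card_eq_one.1 hR
    obtain rfl : M = a := by simpa using hM.1
    rw [covers, List.map_singleton, List.sum_singleton, tableauSum_one_cons hM]
    simp [tableauSum, slide]
  | cons c u ih =>
    have hne' : (R.erase M).Nonempty := Finset.card_pos.1 (by rcases c <;> simp [hcard])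
    obtain ⟨N, hN⟩ : ∃ N, IsGreatest ((R.erase M : Finset (Fin n)) : Set (Fin n)) N :=
      ⟨_, (R.erase M).isGreatest_max' hne'⟩
    have hNM : N < M := hlt N hN.1
    -- If the inserted entry is the maximum `M`, nothing can move on top of it and it stays a column
    -- of height one. Otherwise `M` tops the first column and slides onto the entry.
    rw [← Finset.add_sum_erase R _ hM.1]
    cases c with
    | one =>
      rw [covers, List.map_cons, List.map_singleton, List.sum_cons, List.sum_singleton,
        tableauSum_one_cons hM, tableauSum_two_cons hM, tableauSum_one_cons hN,
        tableauSum_one_cons hN]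
      congr 1
      · simp [slide, hNM.not_gt]
      · refine Finset.sum_congr rfl fun a ha => ?_
        rw [tableauSum_one_cons (hM' a ha), Finset.erase_right_comm]
        simp [slide, hlt a ha]
    | two =>
      rw [covers, List.map_cons, List.map_map, List.sum_cons, tableauSum_one_cons hM,
        tableauSum_two_cons hN, tableauSum_two_cons hN]
      congr 1
      · simp [slide, hNM.not_gt]
      · have h1 : ∀ a ∈ R.erase M, tableauSum (Letter.two :: u) (R.erase a)
            (fun T => f (slide (a.val + 1) T)) =
            ∑ b ∈ (R.erase M).erase a, tableauSum u (((R.erase M).erase a).erase b)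
              (fun T => f (Column.double (a.val + 1) (M.val + 1) :: slide (b.val + 1) T)) := by
          intro a ha
          rw [tableauSum_two_cons (hM' a ha), Finset.erase_right_comm]
          simp [slide, hlt a ha]
        have h2 : ∀ v, tableauSum (Letter.two :: v) R f = ∑ a ∈ R.erase M,
            tableauSum v ((R.erase M).erase a) fun T =>
              f (Column.double (a.val + 1) (M.val + 1) :: T) := fun v => tableauSum_two_cons hM v f
        simp only [Function.comp_def, h2]
        rw [Finset.sum_congr rfl h1]
        have h3 : ∀ a ∈ R.erase M, ((R.erase M).erase a).card = weight u + 1 := by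
          intro a ha
          rw [Finset.card_erase_of_mem ha, hcard, weight_two_cons]
          rfl
        rw [list_sum_map_finset_sum]
        -- For fixed `a`, the old bottom entry `b` is now the entry being slid into the tableaux of
        -- shape `u`: the same identity for `R` without `M` and `a`.
        refine Finset.sum_congr rfl fun a ha => ?_
        have hne2 : ((R.erase M).erase a).Nonempty := Finset.card_pos.1 (by rw [h3 a ha]; omega)
        have hN2 := ((R.erase M).erase a).isGreatest_max' hne2
        set N' := ((R.erase M).erase a).max' hne2
        refine ih _ (h3 a ha) (fun T => f (Column.double (a.val + 1) (M.val + 1) :: T)) hne2 N' hN2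
          (fun b hb => lt_of_le_of_ne (hN2.2 (Finset.mem_of_mem_erase hb))
            (Finset.ne_of_mem_erase hb)) (fun b hb => ⟨?_, fun c hc => ?_⟩) ?_
        · exact Finset.mem_erase.2 ⟨(Finset.ne_of_mem_erase hb).symm, hN2.1⟩
        · exact hN2.2 (Finset.mem_of_mem_erase hc)
        · rw [Finset.card_erase_of_mem hN2.1, h3 a ha]
          rfl

lemma shape_slide_mem_covers (a : ℕ) (T : Tableau) : shape (slide a T) ∈ covers (shape T) := by
  induction T generalizing a with
  | nil => simp [slide, shape, covers, Column.height]
  | cons c T ih =>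
    cases c with
    | single c =>
      simp only [slide]
      split_ifs <;> simp [shape, covers, Column.height]
    | double b c =>
      simp only [slide]
      split_ifs
      · simpa [shape, covers, Column.height] using ih b
      · simp [shape, covers, Column.height]

lemma chainCotransition_single_cons (φ : FibWord → ℝ) (a : ℕ) (T : Tableau) :
    chainCotransition φ (Column.single a :: T) = chainCotransition φ T := by
  have h : shape (Column.single a :: T) = Letter.one :: shape T := rfl
  rw [chainCotransition, h, weight_one_cons, Finset.prod_range_succ']
  have h0 : cotransition φ (shape (eliminate^[0] (Column.single a :: T)))
      (shape (eliminate^[0 + 1] (Column.single a :: T))) = 1 := by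
    simp [eliminate, h, cotransition, Edge.prependOne]
  rw [h0, mul_one]
  rfl

/-- The factor for `j = 0` is split off. The slid shape covers `shape T`, so by reflection the
elimination step is an edge and the cotransition takes its nontrivial value. -/
lemma chainCotransition_double_cons (φ : FibWord → ℝ) (a m : ℕ) (T : Tableau) :
    chainCotransition φ (Column.double a m :: T) =
      φ (shape (slide a T)) / φ (shape T) * chainCotransition φ (slide a T) := by
  have h : shape (Column.double a m :: T) = Letter.two :: shape T := rfl
  have hw : weight (shape (Column.double a m :: T)) = weight (shape (slide a T)) + 1 := by
    rw [h, weight_two_cons, weight_of_mem_covers (shape_slide_mem_covers a T)]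
  have he : Edge (shape (slide a T)) (Letter.two :: shape T) := by
    rw [edge_iff_mem_covers, two_cons_mem_covers_iff]
    exact shape_slide_mem_covers a T
  rw [chainCotransition, hw, Finset.prod_range_succ', mul_comm]
  have h0 : cotransition φ (shape (eliminate^[0] (Column.double a m :: T)))
      (shape (eliminate^[0 + 1] (Column.double a m :: T))) =
        φ (shape (slide a T)) / φ (shape T) := by
    simp [eliminate, h, cotransition, he]
  rw [h0]
  rfl

/-- The cotransition probabilities of the standard tableaux of a given shape add up to one. -/
lemma tableauSum_chainCotransition {φ : FibWord → ℝ} (hφ : ∀ u, 0 < φ u)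
    (hharm : ∀ u, ((covers u).map φ).sum = φ u) (w : FibWord) (R : Finset (Fin n))
    (hR : R.card = weight w) : tableauSum w R (chainCotransition φ) = 1 := by
  induction hn : weight w using Nat.strong_induction_on generalizing w R with
  | _ k ih =>
    subst hn
    rcases w with _ | ⟨_ | _, u⟩
    · simp [tableauSum, chainCotransition, shape]
    · have hne : R.Nonempty := Finset.card_pos.1 (by simp [hR])
      rw [tableauSum_one_cons (R.isGreatest_max' hne)]
      simp only [chainCotransition_single_cons]
      exact ih _ (by simp) u _
        (by rw [Finset.card_erase_of_mem (R.max'_mem hne), hR]; simp) rfl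
    · have hne : R.Nonempty := Finset.card_pos.1 (by simp [hR])
      have hcard : (R.erase (R.max' hne)).card = weight u + 1 := by
        rw [Finset.card_erase_of_mem (R.max'_mem hne), hR]; simp
      rw [tableauSum_two_cons (R.isGreatest_max' hne)]
      set R' := R.erase (R.max' hne)
      -- Since `shape T = u` is fixed, the summand depends on the slid tableau alone, as
      -- `sum_tableauSum_slide` requires. What remains is the sum of `φ v / φ u` over the covers
      -- `v`, which is 1 by harmonicity.
      have h1 : ∀ a ∈ R', tableauSum u (R'.erase a) (fun T => chainCotransition φ
            (Column.double (a.val + 1) ((R.max' hne).val + 1) :: T)) =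
          tableauSum u (R'.erase a) (fun T => (fun T' => φ (shape T') / φ u *
            chainCotransition φ T') (slide (a.val + 1) T)) := fun a _ =>
        tableauSum_congr fun T hT => by rw [chainCotransition_double_cons, hT]
      have h2 : ∀ v ∈ covers u, tableauSum v R' (fun T' => φ (shape T') / φ u *
          chainCotransition φ T') = φ v * (φ u)⁻¹ := by
        intro v hv
        have hwv := weight_of_mem_covers hv
        rw [tableauSum_congr (g := fun T' => φ v / φ u * chainCotransition φ T')
          (fun T hT => by rw [hT]), tableauSum_mul_left, ih (weight v) (by simp [hwv]) v R'
          (by rw [hcard, hwv]) rfl, mul_one, div_eq_mul_inv]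
      rw [Finset.sum_congr rfl h1, sum_tableauSum_slide u R' hcard
        (fun T' => φ (shape T') / φ u * chainCotransition φ T'), List.map_congr_left h2,
        List.sum_map_mul_right, hharm, mul_inv_cancel₀ (hφ u).ne']

lemma chainCotransition_nonneg {φ : FibWord → ℝ} (hφ : ∀ u, 0 < φ u) (T : Tableau) :
    0 ≤ chainCotransition φ T := by
  refine Finset.prod_nonneg fun j _ => ?_
  unfold cotransition
  split_ifs
  · split
    · exact le_rfl
    · exact zero_le_one
    · exact (div_pos (hφ _) (hφ _)).le
  · exact le_rfl

end

/-! ### The insertion tableau of an involution -/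

lemma maxEntry_eq {a m : ℕ} {l : List ℕ} (hm : m ∈ a :: l) (h : ∀ x ∈ a :: l, x ≤ m) :
    maxEntry a l = m := by
  have key : ∀ (l : List ℕ) (k : ℕ), l.foldr max a ≤ k ↔ ∀ x ∈ a :: l, x ≤ k := by
    intro l k
    induction l with
    | nil => simp
    | cons b l ih =>
      rw [List.foldr_cons, max_le_iff, ih]
      simp only [List.forall_mem_cons]
      tauto
  exact le_antisymm ((key l m).2 h) ((key l _).1 le_rfl m hm)

section

variable {n : ℕ} {R : Finset (Fin n)} {M : Fin n} {s : Equiv.Perm (Fin n)}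

/-- The entries of a permutation at the places in `R`, from right to left. -/
def entries (R : Finset (Fin n)) (s : Equiv.Perm (Fin n)) : List ℕ :=
  (R.sort (· ≥ ·)).map fun i => (s i).val + 1

lemma sort_eq_cons (hM : IsGreatest (R : Set (Fin n)) M) :
    R.sort (· ≥ ·) = M :: (R.erase M).sort (· ≥ ·) := by
  conv_lhs => rw [← Finset.insert_erase hM.1]
  exact Finset.sort_insert _ (fun b hb => hM.2 (Finset.mem_of_mem_erase hb))
    (Finset.notMem_erase M R)

lemma sort_erase {a : Fin n} : (R.sort (· ≥ ·)).erase a = (R.erase a).sort (· ≥ ·) := by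
  refine List.Perm.eq_of_pairwise (le := (· ≥ ·)) (fun _ _ _ _ h h' => le_antisymm h' h)
    ((Finset.pairwise_sort R _).sublist List.erase_sublist) (Finset.pairwise_sort _ _) ?_
  rw [List.perm_ext_iff_of_nodup ((Finset.sort_nodup _ _).erase _) (Finset.sort_nodup _ _)]
  intro b
  rw [(Finset.sort_nodup _ _).mem_erase_iff]
  simp

lemma entries_congr {t : Equiv.Perm (Fin n)} (h : ∀ i ∈ R, s i = t i) :
    entries R s = entries R t :=
  List.map_congr_left fun i hi => by rw [h i ((Finset.mem_sort _).1 hi)]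

lemma matchColumns_entries_empty : matchColumns (entries ∅ s) = [] := by
  simp [entries, matchColumns]

lemma entries_eq_cons (hM : IsGreatest (R : Set (Fin n)) M) :
    entries R s = ((s M).val + 1) :: entries (R.erase M) s := by
  rw [entries, sort_eq_cons hM, List.map_cons, entries]

/-- As `s` preserves `R`, the entries at the places of `R` are `R` itself (shifted by one), and `M`
stands at the place `s M`. -/
lemma maxEntry_entries (hM : IsGreatest (R : Set (Fin n)) M) (hs : s * s = 1)
    (hR : ∀ i ∈ R, s i ∈ R) : maxEntry ((s M).val + 1) (entries (R.erase M) s) = M.val + 1 := by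
  apply maxEntry_eq
  · rw [← entries_eq_cons hM]
    refine List.mem_map.2 ⟨s M, by simpa using hR M hM.1, ?_⟩
    rw [← Equiv.Perm.mul_apply, hs, Equiv.Perm.one_apply]
  · rw [← entries_eq_cons hM]
    intro x hx
    obtain ⟨i, hi, rfl⟩ := List.mem_map.1 hx
    have := hM.2 (hR i (by simpa using hi))
    simpa using this

lemma matchColumns_entries_of_fixed (hM : IsGreatest (R : Set (Fin n)) M) (hs : s * s = 1)
    (hR : ∀ i ∈ R, s i ∈ R) (h : s M = M) :
    matchColumns (entries R s) =
      Column.single (M.val + 1) :: matchColumns (entries (R.erase M) s) := by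
  have := maxEntry_entries hM hs hR
  rw [entries_eq_cons hM, matchColumns, if_pos (by rw [this, h]), h]

/-- The rightmost entry is `s M` and the maximum `M` stands at the place `s M`, so one matching step
removes a whole two-cycle and leaves an `s`-stable set of places. -/
lemma matchColumns_entries_of_ne (hM : IsGreatest (R : Set (Fin n)) M) (hs : s * s = 1)
    (hR : ∀ i ∈ R, s i ∈ R) (h : s M ≠ M) :
    matchColumns (entries R s) = Column.double ((s M).val + 1) (M.val + 1) ::
      matchColumns (entries ((R.erase M).erase (s M)) s) := by
  have hmax := maxEntry_entries hM hs hR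
  have hsM : s (s M) = M := by rw [← Equiv.Perm.mul_apply, hs, Equiv.Perm.one_apply]
  have herase : (entries (R.erase M) s).erase (M.val + 1) =
      entries ((R.erase M).erase (s M)) s := by
    have hinj : Function.Injective fun i => (s i).val + 1 := fun i j hij =>
      s.injective (Fin.ext (by simpa using hij))
    have hval : M.val + 1 = (fun i => (s i).val + 1) (s M) := by simp [hsM]
    rw [entries, hval, ← List.map_erase hinj, sort_erase, entries]
  rw [entries_eq_cons hM, matchColumns, hmax, if_neg (by simpa [Fin.ext_iff, eq_comm] using h),
    herase]

lemma insertionTableau_eq (s : Equiv.Perm (Fin n)) :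
    insertionTableau s = matchColumns (entries Finset.univ s) := by
  have h : (Finset.univ : Finset (Fin n)).sort (· ≥ ·) = (List.finRange n).reverse := by
    rw [← Fin.sort_univ]
    refine List.Perm.eq_of_pairwise (le := (· ≥ ·)) (fun _ _ _ _ h h' => le_antisymm h' h)
      (Finset.pairwise_sort _ _) (List.pairwise_reverse.2 (Finset.pairwise_sort _ _)) ?_
    rw [List.perm_ext_iff_of_nodup (Finset.sort_nodup _ _)
      (List.nodup_reverse.2 (Finset.sort_nodup _ _))]
    simp
  rw [insertionTableau, entries, h, List.map_reverse, oneLine, List.ofFn_eq_map]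

/-- The involutions that fix every point outside `R`. -/
def involutionsOn (R : Finset (Fin n)) : Finset (Equiv.Perm (Fin n)) :=
  Finset.univ.filter fun s => s * s = 1 ∧ ∀ i ∉ R, s i = i

lemma mem_involutionsOn : s ∈ involutionsOn R ↔ (∀ i, s (s i) = i) ∧ ∀ i ∉ R, s i = i := by
  simp [involutionsOn, Equiv.ext_iff]

lemma mul_self_of_mem_involutionsOn (h : s ∈ involutionsOn R) : s * s = 1 :=
  (Finset.mem_filter.1 h).2.1

lemma apply_mem_of_mem_involutionsOn (h : s ∈ involutionsOn R) : ∀ i ∈ R, s i ∈ R := by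
  intro i hi
  rw [mem_involutionsOn] at h
  by_contra hc
  have := h.2 _ hc
  rw [h.1] at this
  exact hc (this ▸ hi)

lemma involutionsOn_univ : involutionsOn Finset.univ = involutions n := by
  simp [involutionsOn, involutions]

/-- Multiplication by the transposition adds or removes the two-cycle of `a` and `M`, which is
disjoint from the rest of the involution. -/
lemma swap_mul_mem_involutionsOn {a : Fin n} (hM : M ∈ R) (ha : a ∈ R.erase M) :
    Equiv.swap a M * s ∈ (involutionsOn R).filter (fun t => t M = a) ↔
      s ∈ involutionsOn ((R.erase M).erase a) := by
  simp only [Finset.mem_filter, mem_involutionsOn, Finset.mem_erase, Equiv.Perm.mul_apply,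
    Equiv.swap_apply_def]
  have ha' := Finset.mem_erase.1 ha
  have hinj := s.injective
  constructor
  · rintro ⟨⟨h1, h2⟩, h3⟩
    have hsM : s M = M := by grind
    have hsa : s a = a := by grind
    refine ⟨fun i => ?_, fun i hi => ?_⟩
    · have := h1 i
      have e1 : s i = a → i = a := fun h => hinj (h.trans hsa.symm)
      have e2 : s i = M → i = M := fun h => hinj (h.trans hsM.symm)
      grind
    · have := h2 i
      grind
  · rintro ⟨h1, h2⟩
    have hsM : s M = M := by grind
    have hsa : s a = a := by grind
    refine ⟨⟨fun i => ?_, fun i hi => ?_⟩, ?_⟩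
    · have := h1 i
      grind
    · have := h2 i
      grind
    · grind

/-- Involutions are split according to the image of the largest point of `R`. -/
lemma sum_involutionsOn (hM : M ∈ R) (F : Equiv.Perm (Fin n) → ℝ) :
    ∑ s ∈ involutionsOn R, F s = ∑ s ∈ involutionsOn (R.erase M), F s +
      ∑ a ∈ R.erase M, ∑ t ∈ involutionsOn ((R.erase M).erase a), F (Equiv.swap a M * t) := by
  rw [← Finset.sum_fiberwise_of_maps_to (g := fun s : Equiv.Perm (Fin n) => s M)
    (fun s hs => apply_mem_of_mem_involutionsOn hs M hM), ← Finset.add_sum_erase R _ hM]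
  congr 1
  · refine Finset.sum_congr ?_ fun _ _ => rfl
    ext s
    simp only [Finset.mem_filter, mem_involutionsOn, Finset.mem_erase]
    grind
  · refine Finset.sum_congr rfl fun a ha => ?_
    refine Finset.sum_nbij' (Equiv.swap a M * ·) (Equiv.swap a M * ·) ?_ ?_ ?_ ?_ ?_
    · intro s hs
      rw [← swap_mul_mem_involutionsOn hM ha]
      simpa using hs
    · intro s hs
      exact (swap_mul_mem_involutionsOn hM ha).2 hs
    · simp
    · simp
    · simp

/-- The bijection between involutions and standard tableaux, in summed form: both sides satisfy the
same recursion on the largest point of `R`, fixed or paired with some `a`. -/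
lemma sum_involutionsOn_matchColumns (R : Finset (Fin n)) (g : Tableau → ℝ) :
    ∑ s ∈ involutionsOn R, g (matchColumns (entries R s)) =
      ((words R.card).map fun w => tableauSum w R g).sum := by
  induction hn : R.card using Nat.strong_induction_on generalizing R g with
  | _ k ih =>
    rcases R.eq_empty_or_nonempty with rfl | hne
    · obtain rfl : k = 0 := by simpa using hn.symm
      have : involutionsOn (∅ : Finset (Fin n)) = {1} := by
        ext s
        simp only [mem_involutionsOn, Finset.mem_singleton, Equiv.ext_iff]
        simp
        grind
      simp [this, words, tableauSum, matchColumns_entries_empty]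
    · have hM := R.isGreatest_max' hne
      set M := R.max' hne
      have hcard : (R.erase M).card + 1 = R.card := Finset.card_erase_add_one hM.1
      have h1 : ∀ s ∈ involutionsOn (R.erase M), g (matchColumns (entries R s)) =
          g (Column.single (M.val + 1) :: matchColumns (entries (R.erase M) s)) := by
        intro s hs
        have hsM := (mem_involutionsOn.1 hs).2 M (Finset.notMem_erase M R)
        rw [matchColumns_entries_of_fixed hM (mul_self_of_mem_involutionsOn hs) ?_ hsM]
        intro i hi
        by_cases h : i = M
        · rwa [h, hsM, ← h]
        · exact Finset.mem_of_mem_erase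
            (apply_mem_of_mem_involutionsOn hs i (Finset.mem_erase.2 ⟨h, hi⟩))
      have h2 : ∀ a ∈ R.erase M, ∀ t ∈ involutionsOn ((R.erase M).erase a),
          g (matchColumns (entries R (Equiv.swap a M * t))) =
          g (Column.double (a.val + 1) (M.val + 1) ::
            matchColumns (entries ((R.erase M).erase a) t)) := by
        intro a ha t ht
        have hs := (Finset.mem_filter.1 ((swap_mul_mem_involutionsOn hM.1 ha).2 ht))
        rw [matchColumns_entries_of_ne hM (mul_self_of_mem_involutionsOn hs.1)
          (apply_mem_of_mem_involutionsOn hs.1) (by rw [hs.2]; exact Finset.ne_of_mem_erase ha),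
          hs.2]
        congr 3
        refine entries_congr fun i hi => ?_
        have := apply_mem_of_mem_involutionsOn ht i hi
        simp only [Finset.mem_erase] at this
        exact Equiv.swap_apply_of_ne_of_ne this.1 this.2.1
      rw [sum_involutionsOn hM.1, Finset.sum_congr rfl h1,
        Finset.sum_congr rfl fun a ha => Finset.sum_congr rfl (h2 a ha),
        ih _ (by omega) (R.erase M) (fun T => g (Column.single (M.val + 1) :: T)) rfl]
      have h3 : ∀ a ∈ R.erase M, ((R.erase M).erase a).card + 1 = (R.erase M).card :=
        fun a ha => Finset.card_erase_add_one ha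
      rw [Finset.sum_congr rfl fun a ha => ih ((R.erase M).erase a).card (by have := h3 a ha; omega)
        ((R.erase M).erase a)
        (fun T => g (Column.double (a.val + 1) (M.val + 1) :: T)) rfl]
      -- `words` branches only from weight 2 on; for a single point the sum over partners `a` is
      -- empty.
      rcases k with _ | _ | k
      · omega
      · have h0 : (R.erase M).card = 0 := by omega
        rw [h0, Finset.card_eq_zero.1 h0]
        rw [show words (0 + 1) = [[Letter.one]] from rfl, List.map_singleton, List.sum_singleton,
          tableauSum_one_cons hM]
        simp [words, tableauSum]
      · have h0 : (R.erase M).card = k + 1 := by omega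
        rw [sum_words_succ_succ, h0]
        simp only [tableauSum_one_cons hM, tableauSum_two_cons hM]
        rw [list_sum_map_finset_sum]
        congr 1
        refine Finset.sum_congr rfl fun a ha => ?_
        rw [show ((R.erase M).erase a).card = k by have := h3 a ha; omega]

/-! ### Cycles -/

/-- Each column of height two consumes exactly two moved points, each column of height one a fixed
point. -/
lemma two_mul_numTwos_shape (hs : s * s = 1) (R : Finset (Fin n)) (hR : ∀ i ∈ R, s i ∈ R) :
    2 * numTwos (shape (matchColumns (entries R s))) = (R.filter fun i => s i ≠ i).card := by
  have hss : ∀ i, s (s i) = i := fun i => by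
    rw [← Equiv.Perm.mul_apply, hs, Equiv.Perm.one_apply]
  have hinj := s.injective
  induction hn : R.card using Nat.strong_induction_on generalizing R with
  | _ k ih =>
    rcases R.eq_empty_or_nonempty with rfl | hne
    · simp [matchColumns_entries_empty, shape, numTwos]
    · have hM := R.isGreatest_max' hne
      set M := R.max' hne
      have hcard : (R.erase M).card + 1 = R.card := Finset.card_erase_add_one hM.1
      by_cases h : s M = M
      · rw [matchColumns_entries_of_fixed hM hs hR h]
        simp only [shape, List.map_cons, Column.height, numTwos]
        have := ih (R.erase M).card (by omega) (R.erase M) (fun i hi => by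
          rw [Finset.mem_erase] at hi ⊢
          exact ⟨fun h' => hi.1 (hinj (h'.trans h.symm)), hR i hi.2⟩) rfl
        rw [shape] at this
        rw [this, Finset.filter_erase, Finset.erase_eq_of_notMem (by simp [h])]
      · have hsR : s M ∈ R.erase M := Finset.mem_erase.2 ⟨h, hR M hM.1⟩
        have hc2 := Finset.card_erase_add_one hsR
        rw [matchColumns_entries_of_ne hM hs hR h]
        simp only [shape, List.map_cons, Column.height, numTwos]
        have := ih ((R.erase M).erase (s M)).card (by omega) ((R.erase M).erase (s M))
          (fun i hi => by
            simp only [Finset.mem_erase] at hi ⊢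
            exact ⟨fun h' => hi.2.1 (hinj h'), fun h' => hi.1 (by rw [← h', hss]), hR i hi.2.2⟩)
          rfl
        rw [shape] at this
        rw [mul_add, this, Finset.filter_erase, Finset.filter_erase]
        have e1 : M ∈ R.filter fun i => s i ≠ i := Finset.mem_filter.2 ⟨hM.1, h⟩
        have e2 : s M ∈ (R.filter fun i => s i ≠ i).erase M := by
          simp only [Finset.mem_erase, Finset.mem_filter, hss]
          exact ⟨h, hR M hM.1, Ne.symm h⟩
        rw [← Finset.card_erase_add_one e1, ← Finset.card_erase_add_one e2]

lemma two_mul_numTwoCycles (hs : s * s = 1) : 2 * numTwoCycles s = s.support.card := by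
  have h : ∀ m ∈ s.cycleType, m = 2 := fun m hm =>
    le_antisymm (Nat.le_of_dvd two_pos ((Equiv.Perm.dvd_of_mem_cycleType hm).trans
      (orderOf_dvd_of_pow_eq_one (by rw [pow_two, hs]))))
      (Equiv.Perm.two_le_of_mem_cycleType hm)
  rw [← Equiv.Perm.sum_cycleType, Multiset.eq_replicate_card.2 h, numTwoCycles,
    Multiset.eq_replicate_card.2 h]
  simp [mul_comm]

lemma numTwoCycles_eq (hs : s * s = 1) : numTwoCycles s = numTwos (shape (insertionTableau s)) := by
  have h := two_mul_numTwos_shape hs Finset.univ (fun _ _ => Finset.mem_univ _)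
  rw [← insertionTableau_eq] at h
  have h2 := two_mul_numTwoCycles hs
  have : s.support = Finset.univ.filter fun i => s i ≠ i := by ext; simp
  rw [this] at h2
  omega

/-! ### The law of the shape of a random involution -/

/-- The cotransition weights of the tableaux of a given shape add up to 1, so averaging a function
of the shape reduces to a sum over words. -/
lemma sum_involutions_mul_chainCotransition {φ : FibWord → ℝ} (hφ : ∀ u, 0 < φ u)
    (hharm : ∀ u, ((covers u).map φ).sum = φ u) (n : ℕ) (H : FibWord → ℝ) :
    ∑ s ∈ involutions n, H (shape (insertionTableau s)) *
        chainCotransition φ (insertionTableau s) = ((words n).map H).sum := by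
  simp only [insertionTableau_eq, ← involutionsOn_univ]
  rw [sum_involutionsOn_matchColumns Finset.univ fun T => H (shape T) * chainCotransition φ T,
    Finset.card_univ, Fintype.card_fin]
  refine congrArg List.sum (List.map_congr_left fun w hw => ?_)
  rw [tableauSum_congr (g := fun T => H w * chainCotransition φ T) (fun T hT => by rw [hT]),
    tableauSum_mul_left, tableauSum_chainCotransition hφ hharm w _
      (by simp [weight_of_mem_words hw]), mul_one]

lemma dim_mul_cloneHarmonic {σ : ℝ} {n : ℕ} {w : FibWord} (hw : w ∈ words n) :
    dim w * cloneHarmonic (shiftedPlancherel σ) (shiftedPlancherel σ) w =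
      (risingProd σ n)⁻¹ * (dim w * schurShifted σ w) := by
  rw [cloneHarmonic, weight_of_mem_words hw, prod_shiftedPlancherel, schurShifted]
  ring

lemma nuShifted_nonneg {σ : ℝ} (hσ : 1 ≤ σ) (s : Equiv.Perm (Fin n)) :
    0 ≤ nuShifted σ n s := by
  refine mul_nonneg (mul_nonneg (Nat.cast_nonneg _) ?_)
    (chainCotransition_nonneg plancherel_pos _)
  rw [cloneHarmonic, prod_shiftedPlancherel]
  exact (div_pos (schurShifted_pos hσ _) (risingProd_pos (by linarith) _)).le

lemma sum_nuShifted {σ : ℝ} (hσ : 1 ≤ σ) (n : ℕ) : ∑ s ∈ involutions n, nuShifted σ n s = 1 := by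
  simp only [nuShifted, nu]
  rw [sum_involutions_mul_chainCotransition plancherel_pos sum_plancherel_covers n fun w =>
      dim w * cloneHarmonic (shiftedPlancherel σ) (shiftedPlancherel σ) w,
    List.map_congr_left fun w hw => dim_mul_cloneHarmonic hw, List.sum_map_mul_left,
    sum_words_dim_mul_schurShifted, inv_mul_cancel₀ (risingProd_pos (by linarith) n).ne']

lemma expectedTwoCycles_eq (σ : ℝ) (n : ℕ) :
    expectedTwoCycles σ n = twosMoment σ n / risingProd σ n := by
  have h : ∀ s ∈ involutions n, nuShifted σ n s * (numTwoCycles s : ℝ) =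
      (fun w => dim w * cloneHarmonic (shiftedPlancherel σ) (shiftedPlancherel σ) w * numTwos w)
        (shape (insertionTableau s)) * chainCotransition plancherel (insertionTableau s) := by
    intro s hs
    rw [numTwoCycles_eq (Finset.mem_filter.1 hs).2, nuShifted, nu]
    ring
  have h2 : ∀ w ∈ words n, dim w * cloneHarmonic (shiftedPlancherel σ) (shiftedPlancherel σ) w *
      numTwos w = (risingProd σ n)⁻¹ * (dim w * schurShifted σ w * numTwos w) := by
    intro w hw
    rw [dim_mul_cloneHarmonic hw]
    ring
  rw [expectedTwoCycles, Finset.sum_congr rfl h, sum_involutions_mul_chainCotransition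
    plancherel_pos sum_plancherel_covers n fun w =>
      dim w * cloneHarmonic (shiftedPlancherel σ) (shiftedPlancherel σ) w * numTwos w, List.map_congr_left h2, List.sum_map_mul_left,
    div_eq_inv_mul, twosMoment]

end

end YoungFibonacci

theorem mainTheorem11 (σ : ℝ) (hσ : 1 ≤ σ) :
    (∀ n : ℕ,
      (∀ s ∈ YoungFibonacci.involutions n, 0 ≤ YoungFibonacci.nuShifted σ n s) ∧
      ∑ s ∈ YoungFibonacci.involutions n, YoungFibonacci.nuShifted σ n s = 1) ∧
    Tendsto (fun n : ℕ => YoungFibonacci.expectedTwoCycles σ n / (n : ℝ)) atTop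
      (𝓝 (1 / (σ + 1))) := by
  refine ⟨fun n => ⟨fun s _ => YoungFibonacci.nuShifted_nonneg hσ s,
    YoungFibonacci.sum_nuShifted hσ n⟩, ?_⟩
  simp only [YoungFibonacci.expectedTwoCycles_eq]
  exact YoungFibonacci.tendsto_twosMoment hσ
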